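/- Let $k\ge 3$, $A=\{0,1,\dots,k-1\}$, let $p$ be a prime divisor of $k$, let $\pi$ be a (necessarily fixed-point-free) permutation of $A$ all of whose cycles have length $p$, and let $\le$ be a linear order on $A$. A partial function on $A$ is a map $f:\operatorname{dom}(f)\to A$ with $\operatorname{dom}(f)\subseteq A^n$ for some $n\ge1$. The composition $f[g_1,\dots,g_n]$ is defined at $a$ exactly when all $g_i(a)$ are defined and $f$ is defined at $(g_1(a),\dots,g_n(a))$. A partial clone is a set of partial functions on $A$ that contains all (total) projections and is closed under composition. It is maximal if it is different from the set $\mathrm{Par}(A)$ of all partial functions and no partial clone lies strictly between it and $\mathrm{Par}(A)$. It is finitely generated if it is the least partial clone containing some finite subset of itself. For an $h$-ary relation $\varrho$ on $A$, $\mathrm{pPol}(\varrho)$ is the set of all partial functions $f$ such that, for every $h\times n$ matrix ($n$ the arity of $f$) whose columns lie in $\varrho$ and whose rows lie in $\operatorname{dom}(f)$, the column of the values of $f$ on the rows lies in $\varrho$. Put $\varrho_\pi=\{(x,\pi(x),\dots,\pi^{p-1}(x)) : x\in A\}$. Then $\mathrm{pPol}(\varrho_\pi)$ and $\mathrm{pPol}(\le)$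 are finitely generated maximal partial clones on $A$, and $\mathrm{pPol}(\varrho_\pi)\cap\mathrm{pPol}(\le)$ is a partial clone. If, moreover, $\pi$ is the permutation $$\pi=(a_0\,a_1\,\dots\,a_{p-1})(a_p\,a_{p+1}\,\dots\,a_{2p-1})\cdots(a_{k-p}\,a_{k-p+1}\,\dots\,a_{k-1}),$$ where $a_0<a_1<\dots<a_{k-1}$ are the elements of $A$ listed in the order $\le$, then the partial clone $\mathrm{pPol}(\varrho_\pi)\cap\mathrm{pPol}(\le)$ is not finitely generated. -/

import Mathlib

namespace PartialClones

/-- `Par A`: all partial functions of positive arity on `A`. -/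
abbrev Par (A : Type*) := Σ n : ℕ+, ((Fin n → A) →. A)

/-- The `n`-ary `i`-th projection, defined everywhere. -/
def proj {A : Type*} {n : ℕ} (i : Fin n) : (Fin n → A) →. A :=
  fun a => Part.some (a i)

/-- Composition `f[g₁, …, gₙ]`; it is defined at `a` exactly when every `gᵢ` is defined at `a`
and `f` is defined at `(g₁ a, …, gₙ a)`. -/
def comp {A : Type*} {n m : ℕ} (f : (Fin n → A) →. A) (g : Fin n → ((Fin m → A) →. A)) :
    (Fin m → A) →. A :=
  fun a =>
    { Dom := ∃ h : ∀ i, (g i a).Dom, (f (fun i => (g i a).get (h i))).Dom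
      get := fun h => (f (fun i => (g i a).get (h.1 i))).get h.2 }

/-- A partial clone: a set of partial functions that contains all projections and is closed under
composition. -/
def IsPartialClone {A : Type*} (C : Set (Par A)) : Prop :=
  (∀ (n : ℕ+) (i : Fin n), (⟨n, proj i⟩ : Par A) ∈ C) ∧
  ∀ (n m : ℕ+) (f : (Fin n → A) →. A) (g : Fin n → ((Fin m → A) →. A)),
    (⟨n, f⟩ : Par A) ∈ C → (∀ i, (⟨m, g i⟩ : Par A) ∈ C) → (⟨m, comp f g⟩ : Par A) ∈ C

/-- The partial clone generated by `F`: the intersection of all partial clones containing `F`. -/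
def generated {A : Type*} (F : Set (Par A)) : Set (Par A) :=
  ⋂₀ {C | IsPartialClone C ∧ F ⊆ C}

/-- `C` is the partial clone generated by some finite subset of `C`. -/
def IsFinitelyGenerated {A : Type*} (C : Set (Par A)) : Prop :=
  ∃ F : Set (Par A), F.Finite ∧ F ⊆ C ∧ generated F = C

/-- A maximal partial clone: a proper partial clone with no partial clone strictly between it and
the set of all partial functions. -/
def IsMaximalPartialClone {A : Type*} (C : Set (Par A)) : Prop :=
  IsPartialClone C ∧ C ⊂ Set.univ ∧
    ¬ ∃ C' : Set (Par A), IsPartialClone C' ∧ C ⊂ C' ∧ C' ⊂ Set.univ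

/-- `f` preserves the `h`-ary relation `ρ`: for every `h × n` matrix `M` with all columns in `ρ` and
all rows in the domain of `f`, the column of the values of `f` on the rows is in `ρ`. -/
def Preserves {A : Type*} {n h : ℕ} (f : (Fin n → A) →. A) (ρ : Set (Fin h → A)) : Prop :=
  ∀ M : Fin h → Fin n → A, (∀ j, (fun i => M i j) ∈ ρ) →
    ∀ hd : ∀ i, (f (M i)).Dom, (fun i => (f (M i)).get (hd i)) ∈ ρ

/-- `pPol ρ`: all partial functions preserving `ρ`. -/
def pPol {A : Type*} {h : ℕ} (ρ : Set (Fin h → A)) : Set (Par A) :=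
  {f | Preserves f.2 ρ}

/-- The relation `{(x, π x, π² x, …, π^(p-1) x) | x ∈ A}`. -/
def cycleRel {A : Type*} (p : ℕ) (π : Equiv.Perm A) : Set (Fin p → A) :=
  {v | ∃ x : A, ∀ i : Fin p, v i = (π ^ (i : ℕ)) x}

/-- A binary relation as a set of pairs `Fin 2 → A`. -/
def binRel {A : Type*} (r : A → A → Prop) : Set (Fin 2 → A) :=
  {v | r (v 0) (v 1)}

/-- If `e 0, e 1, …, e (k-1)` is the increasing enumeration of `{0, …, k-1}` with respect to `le`,
then `π = (e 0 e 1 … e (p-1)) (e p … e (2p-1)) … (e (k-p) … e (k-1))`. -/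
def IsBlockRotation {k : ℕ} (p : ℕ) (le : Fin k → Fin k → Prop) (π : Equiv.Perm (Fin k)) : Prop :=
  ∃ e : Fin k ≃ Fin k, (∀ i j, le (e i) (e j) ↔ i ≤ j) ∧
    ∀ i j : Fin k,
      (j : ℕ) = (if p ∣ (i : ℕ) + 1 then (i : ℕ) + 1 - p else (i : ℕ) + 1) → π (e i) = e j

end PartialClones

/-! Maximality: a function violating the relation yields, after substitution of total members of the
clone, total functions s such that the only matrices compatible with both the relation and s are
harmless for every target g. Appending the values of s as extra arguments puts g into the larger
clone (`restrict_mem_of_pPol_subset`).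

Finite generation: on a finite set there are finitely many ternary partial functions, and the
ternary members of `pPol` already generate it. For the cycles, one glues over the sets of tuples
h(u), with h equivariant; for the order, one extends a partial monotone function to a total one by
suprema and then deletes points from the domain.

The intersection: by `exists_eq_proj`, a total monotone operation commuting with the block rotation
is a projection. Let z be a point and consider the n-tuples with at most N coordinates different
from z. Every member of the intersection of arity at most N preserves the relation formed by the
coordinate functions on these tuples (`mem_polOn_coordRel`): substituting coordinates makes it
total, hence a projection. The constant z with exactly this domain violates the relation if N is at
least 1. For n > 2N it lies in the intersection, because x and π x never both belong to the domain.
So no bound on the arity of generators is possible. -/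

namespace PartialClones

variable {A : Type*}

/-! ### Partial functions as restricted total functions, and their compositions -/

/-- The restriction of a total function `G` to the domain `D`. -/
def restrict {n : ℕ} (D : (Fin n → A) → Prop) (G : (Fin n → A) → A) : (Fin n → A) →. A :=
  fun a => ⟨D a, fun _ => G a⟩

theorem restrict_congr {n : ℕ} {D D' : (Fin n → A) → Prop} {G G' : (Fin n → A) → A}
    (hD : ∀ a, D a ↔ D' a) (hG : ∀ a, D a → G a = G' a) : restrict D G = restrict D' G' := by
  funext a
  exact Part.ext' (hD a) fun h _ => hG a h

theorem exists_eq_restrict [Nonempty A] {n : ℕ} (f : (Fin n → A) →. A) :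
    ∃ D G, f = restrict D G := by
  classical
  refine ⟨fun a => (f a).Dom,
    fun a => if h : (f a).Dom then (f a).get h else Classical.arbitrary A, ?_⟩
  funext a
  exact Part.ext' Iff.rfl fun h _ => by simp [restrict, h]

theorem comp_restrict {n m : ℕ} (D : (Fin n → A) → Prop) (G : (Fin n → A) → A)
    (D' : Fin n → (Fin m → A) → Prop) (G' : Fin n → (Fin m → A) → A) :
    comp (restrict D G) (fun i => restrict (D' i) (G' i)) =
      restrict (fun a => (∀ i, D' i a) ∧ D (fun i => G' i a)) (fun a => G fun i => G' i a) := by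
  funext a
  exact Part.ext' ⟨fun ⟨h, h'⟩ => ⟨h, h'⟩, fun ⟨h, h'⟩ => ⟨h, h'⟩⟩ fun _ _ => rfl

theorem IsPartialClone.restrict_comp_mem {C : Set (Par A)} (hC : IsPartialClone C) {n m : ℕ+}
    {D : (Fin n → A) → Prop} {G : (Fin n → A) → A}
    {D' : Fin n → (Fin m → A) → Prop} {G' : Fin n → (Fin m → A) → A}
    (h : (⟨n, restrict D G⟩ : Par A) ∈ C)
    (h' : ∀ i, (⟨m, restrict (D' i) (G' i)⟩ : Par A) ∈ C) :
    (⟨m, restrict (fun a => (∀ i, D' i a) ∧ D (fun i => G' i a))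
      (fun a => G fun i => G' i a)⟩ : Par A) ∈ C := by
  rw [← comp_restrict]
  exact hC.2 n m _ _ h h'

theorem IsPartialClone.restrict_proj_mem {C : Set (Par A)} (hC : IsPartialClone C) {n : ℕ+}
    (i : Fin n) : (⟨n, restrict (fun _ => True) fun a => a i⟩ : Par A) ∈ C :=
  hC.1 n i

/-- The ternary partial function with domain `D` and values given by `G`. -/
def ternary (D : A → A → A → Prop) (G : A → A → A → A) : Par A :=
  ⟨⟨3, by norm_num⟩, restrict (fun v : Fin 3 → A => D (v 0) (v 1) (v 2))
    (fun v : Fin 3 → A => G (v 0) (v 1) (v 2))⟩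

theorem IsPartialClone.ternary_comp_mem {C : Set (Par A)} (hC : IsPartialClone C) {m : ℕ+}
    {D : A → A → A → Prop} {G : A → A → A → A} (h : ternary D G ∈ C)
    {D₀ D₁ D₂ : (Fin m → A) → Prop} {G₀ G₁ G₂ : (Fin m → A) → A}
    (h₀ : (⟨m, restrict D₀ G₀⟩ : Par A) ∈ C) (h₁ : (⟨m, restrict D₁ G₁⟩ : Par A) ∈ C)
    (h₂ : (⟨m, restrict D₂ G₂⟩ : Par A) ∈ C) :
    (⟨m, restrict (fun a => (D₀ a ∧ D₁ a ∧ D₂ a) ∧ D (G₀ a) (G₁ a) (G₂ a))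
      (fun a => G (G₀ a) (G₁ a) (G₂ a))⟩ : Par A) ∈ C := by
  have key := hC.restrict_comp_mem (n := ⟨3, by norm_num⟩) (m := m) (D' := ![D₀, D₁, D₂])
    (G' := ![G₀, G₁, G₂]) h (fun i => by
      change Fin 3 at i
      fin_cases i
      · exact h₀
      · exact h₁
      · exact h₂)
  convert key using 2
  refine restrict_congr (fun a => and_congr ?_ Iff.rfl) fun a _ => rfl
  refine ⟨fun ⟨a0, a1, a2⟩ i => ?_, fun h =>
    ⟨h (0 : Fin 3), h (1 : Fin 3), h (2 : Fin 3)⟩⟩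
  change Fin 3 at i
  fin_cases i
  · exact a0
  · exact a1
  · exact a2

theorem IsPartialClone.ternary_comp_total_mem {C : Set (Par A)} (hC : IsPartialClone C) {m : ℕ+}
    {G : A → A → A → A} (h : ternary (fun _ _ _ => True) G ∈ C) {G₀ G₁ G₂ : (Fin m → A) → A}
    (h₀ : (⟨m, restrict (fun _ => True) G₀⟩ : Par A) ∈ C)
    (h₁ : (⟨m, restrict (fun _ => True) G₁⟩ : Par A) ∈ C)
    (h₂ : (⟨m, restrict (fun _ => True) G₂⟩ : Par A) ∈ C) :
    (⟨m, restrict (fun _ => True) (fun a => G (G₀ a) (G₁ a) (G₂ a))⟩ : Par A) ∈ C := by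
  have key := hC.ternary_comp_mem h h₀ h₁ h₂
  convert key using 3
  simp

/-! ### Clones of relations; criteria for maximality and finite generation -/

/-- Partial functions preserving a relation whose positions are indexed by an arbitrary type. -/
def polOn {ι : Type*} (ρ : Set (ι → A)) : Set (Par A) :=
  {f | ∀ M : ι → Fin f.1 → A, (∀ j, (fun i => M i j) ∈ ρ) →
    ∀ hd : ∀ i, (f.2 (M i)).Dom, (fun i => (f.2 (M i)).get (hd i)) ∈ ρ}

theorem isPartialClone_polOn {ι : Type*} (ρ : Set (ι → A)) : IsPartialClone (polOn ρ) :=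
  ⟨fun _ i _ hM _ => hM i, fun _ _ _ _ hf hg M hM hd =>
    hf _ (fun j => hg j M hM fun i => (hd i).1 j) fun i => (hd i).2⟩

theorem isPartialClone_pPol {h : ℕ} (ρ : Set (Fin h → A)) : IsPartialClone (pPol ρ) :=
  isPartialClone_polOn ρ

theorem restrict_mem_polOn {ι : Type*} {ρ : Set (ι → A)} {n : ℕ+} {D : (Fin n → A) → Prop}
    {G : (Fin n → A) → A} : (⟨n, restrict D G⟩ : Par A) ∈ polOn ρ ↔
      ∀ M : ι → Fin n → A, (∀ j, (fun i => M i j) ∈ ρ) → (∀ i, D (M i)) →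
        (fun i => G (M i)) ∈ ρ :=
  Iff.rfl

theorem restrict_mem_pPol {h : ℕ} {ρ : Set (Fin h → A)} {n : ℕ+} {D : (Fin n → A) → Prop}
    {G : (Fin n → A) → A} : (⟨n, restrict D G⟩ : Par A) ∈ pPol ρ ↔
      ∀ M : Fin h → Fin n → A, (∀ j, (fun i => M i j) ∈ ρ) → (∀ i, D (M i)) →
        (fun i => G (M i)) ∈ ρ :=
  Iff.rfl

theorem IsPartialClone.inter {C C' : Set (Par A)} (hC : IsPartialClone C)
    (hC' : IsPartialClone C') : IsPartialClone (C ∩ C') :=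
  ⟨fun n i => ⟨hC.1 n i, hC'.1 n i⟩, fun n m f g hf hg =>
    ⟨hC.2 n m f g hf.1 fun i => (hg i).1, hC'.2 n m f g hf.2 fun i => (hg i).2⟩⟩

/-- A clone above `pPol ρ` contains every function that is undetermined by `ρ` once its arguments
are extended by the values of total functions of the clone. -/
theorem IsPartialClone.restrict_mem_of_pPol_subset {C : Set (Par A)} (hC : IsPartialClone C)
    {h : ℕ} {ρ : Set (Fin h → A)} (hρ : pPol ρ ⊆ C) {m : ℕ+} {D : (Fin m → A) → Prop}
    {G : (Fin m → A) → A} {q : ℕ} (s : Fin q → (Fin m → A) → A)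
    (hs : ∀ j, (⟨m, restrict (fun _ => True) (s j)⟩ : Par A) ∈ C)
    (H : ∀ M : Fin h → Fin m → A, (∀ j, (fun i => M i j) ∈ ρ) →
      (∀ j, (fun i => s j (M i)) ∈ ρ) → (∀ i, D (M i)) → (fun i => G (M i)) ∈ ρ) :
    (⟨m, restrict D G⟩ : Par A) ∈ C := by
  -- The extra q arguments are forced by the domain to carry the values of s. In a matrix they are
  -- columns in ρ, which supplies the additional hypothesis of `H`.
  let N : ℕ+ := ⟨m + q, Nat.add_pos_left m.pos q⟩
  let DB : (Fin N → A) → Prop := fun z =>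
    D (fun i => z (Fin.castAdd q i)) ∧
      ∀ j : Fin q, z (Fin.natAdd m j) = s j (fun i => z (Fin.castAdd q i))
  let GB : (Fin N → A) → A := fun z => G (fun i => z (Fin.castAdd q i))
  have hB : (⟨N, restrict DB GB⟩ : Par A) ∈ C := by
    refine hρ (restrict_mem_pPol.2 fun M hM hD => ?_)
    refine H (fun i j => M i (Fin.castAdd q j)) (fun j => hM _) (fun j => ?_) fun i => (hD i).1
    have e : (fun i => s j fun l => M i (Fin.castAdd q l)) = fun i => M i (Fin.natAdd m j) :=
      funext fun i => ((hD i).2 j).symm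
    rw [e]
    exact hM _
  let G' : Fin N → (Fin m → A) → A := fun i a => Fin.addCases (m := m) (n := q) a (fun j => s j a) i
  have eL : ∀ i, G' (Fin.castAdd q i) = fun a => a i := fun i =>
    funext fun a => Fin.addCases_left (motive := fun _ => A) i
  have eR : ∀ j, G' (Fin.natAdd m j) = s j := fun j =>
    funext fun a => Fin.addCases_right (motive := fun _ => A) j
  have hG' : ∀ i, (⟨m, restrict (fun _ => True) (G' i)⟩ : Par A) ∈ C := by
    intro i
    change Fin (m + q) at i
    refine Fin.addCases (fun j => ?_) (fun j => ?_) i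
    · rw [eL]
      exact hC.restrict_proj_mem j
    · rw [eR]
      exact hs j
  have key := hC.restrict_comp_mem hB hG'
  convert key using 2
  have e : ∀ a : Fin m → A, (fun i => G' (Fin.castAdd q i) a) = a := fun a =>
    funext fun i => congrFun (eL i) a
  refine restrict_congr (fun a => ?_) fun a _ => ?_
  · simp [DB, e, eR]
  · simp only [GB, e]

/-- Maximality follows if every function outside `C` generates everything together with `C`. -/
theorem isMaximalPartialClone_of {C : Set (Par A)} (hC : IsPartialClone C) (hne : ∃ f, f ∉ C)
    (h : ∀ C', IsPartialClone C' → C ⊆ C' → ∀ f ∈ C', f ∉ C → ∀ g, g ∈ C') :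
    IsMaximalPartialClone C := by
  obtain ⟨f, hf⟩ := hne
  refine ⟨hC, (Set.ssubset_univ_iff).2 fun e => hf (e ▸ Set.mem_univ f), ?_⟩
  rintro ⟨C', hC', hlt, hlt'⟩
  obtain ⟨f, hf', hf⟩ := Set.exists_of_ssubset hlt
  exact hlt'.ne (Set.eq_univ_of_forall (h C' hC' hlt.1 f hf' hf))

theorem finite_setOf_arity_lt [Finite A] (N : ℕ) : {f : Par A | (f.1 : ℕ) < N}.Finite := by
  have : Finite (Part A) := Finite.of_equiv _ (open Classical in Part.equivOption (α := A)).symm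
  have hfin : {n : ℕ+ | (n : ℕ) < N}.Finite :=
    (Set.finite_lt_nat N).preimage PNat.coe_injective.injOn
  have : ∀ n : ℕ+, Finite ((Fin n → A) →. A) := fun n =>
    inferInstanceAs (Finite ((Fin n → A) → Part A))
  refine (hfin.biUnion fun n _ => Set.finite_range fun f => (⟨n, f⟩ : Par A)).subset ?_
  rintro ⟨n, f⟩ hn
  exact Set.mem_biUnion (show n ∈ {n : ℕ+ | (n : ℕ) < N} from hn) ⟨f, rfl⟩

/-- Partial functions of arity below 4 on a finite set are finite in number, so the generating set
can consist of all those lying in `C`. -/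
theorem isFinitelyGenerated_of_ternary [Finite A] {C : Set (Par A)} (hC : IsPartialClone C)
    (h : ∀ C', IsPartialClone C' → (∀ D G, ternary D G ∈ C → ternary D G ∈ C') → C ⊆ C') :
    IsFinitelyGenerated C := by
  refine ⟨C ∩ {f | (f.1 : ℕ) < 4}, (finite_setOf_arity_lt 4).inter_of_right C,
    Set.inter_subset_left, Set.Subset.antisymm ?_ ?_⟩
  · exact Set.sInter_subset_of_mem ⟨hC, Set.inter_subset_left⟩
  · refine Set.subset_sInter ?_
    rintro C' ⟨hC', hsub⟩
    refine h C' hC' fun D G hDG => hsub ⟨hDG, ?_⟩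
    change 3 < 4
    norm_num

/-! ### The clone of a permutation with cycles of equal length -/

section Cycle

variable {p : ℕ} {π : Equiv.Perm A}

theorem pow_eq_one_of_minimalPeriod (hπ : ∀ x, Function.minimalPeriod π x = p) : π ^ p = 1 := by
  ext x
  rw [← Equiv.Perm.iterate_eq_pow, ← hπ x, Function.iterate_minimalPeriod]
  rfl

theorem pow_eq_pow_of_apply_eq (hp : 0 < p) (hπ : ∀ x, Function.minimalPeriod π x = p)
    {m n : ℕ} {r : A} (h : (π ^ m) r = (π ^ n) r) : π ^ m = π ^ n := by
  have h1 := pow_eq_one_of_minimalPeriod hπ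
  rw [← Equiv.Perm.iterate_eq_pow, ← Equiv.Perm.iterate_eq_pow,
    ← Function.iterate_mod_minimalPeriod_eq, ← Function.iterate_mod_minimalPeriod_eq (n := n),
    Function.iterate_eq_iterate_iff_of_lt_minimalPeriod, hπ r] at h
  · rw [pow_eq_pow_mod m h1, pow_eq_pow_mod n h1, h]
  · exact Nat.mod_lt _ (by rw [hπ r]; exact hp)
  · exact Nat.mod_lt _ (by rw [hπ r]; exact hp)

/-- Each point has a phase, which `π` advances by one. -/
theorem exists_phase [Finite A] (hp : 0 < p) (hπ : ∀ x, Function.minimalPeriod π x = p) :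
    ∃ τ : A → ℕ, ∀ z, π ^ τ (π z) = π ^ (τ z + 1) := by
  let s := Equiv.Perm.SameCycle.setoid π
  -- The phase counts steps from a chosen representative of the cycle. It is determined only modulo
  -- p, so it is compared through powers of π.
  have h : ∀ z : A, ∃ n : ℕ, (π ^ n) (Quotient.mk s z).out = z := fun z =>
    Equiv.Perm.SameCycle.exists_nat_pow_eq (Quotient.exact (Quotient.out_eq (Quotient.mk s z)))
  choose τ hτ using h
  refine ⟨τ, fun z => pow_eq_pow_of_apply_eq hp hπ (r := (Quotient.mk s z).out) ?_⟩
  have e : Quotient.mk s (π z) = Quotient.mk s z :=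
    Quotient.sound ((Equiv.Perm.sameCycle_apply_left).2 (Equiv.Perm.SameCycle.refl π z))
  have h1 := hτ (π z)
  rw [e] at h1
  rw [h1, pow_succ', Equiv.Perm.mul_apply, hτ z]

/-- The map sends z to b moved by the phase difference between z and a. -/
theorem exists_equivariant [Finite A] (hp : 0 < p) (hπ : ∀ x, Function.minimalPeriod π x = p)
    (a b : A) : ∃ h : A → A, (∀ z, h (π z) = π (h z)) ∧ h a = b := by
  obtain ⟨τ, hτ⟩ := exists_phase hp hπ
  refine ⟨fun z => (π ^ τ z) ((π ^ τ a)⁻¹ b), fun z => ?_, by simp⟩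
  simp only [hτ]
  rw [pow_succ', Equiv.Perm.mul_apply]

/-- A matrix with columns in the relation lists the orbit of one tuple x, so preservation is
one-step equivariance along orbits contained entirely in the domain. -/
theorem restrict_mem_pPol_cycleRel (hp : 1 < p) (hπ : ∀ x, Function.minimalPeriod π x = p)
    {n : ℕ+} {D : (Fin n → A) → Prop} {G : (Fin n → A) → A} :
    (⟨n, restrict D G⟩ : Par A) ∈ pPol (cycleRel p π) ↔
      ∀ x : Fin n → A, (∀ i : ℕ, D fun j => (π ^ i) (x j)) →
        G (fun j => π (x j)) = π (G x) := by
  have h1 := pow_eq_one_of_minimalPeriod hπ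
  rw [restrict_mem_pPol]
  constructor
  · intro H x hx
    obtain ⟨c, hc⟩ := H (fun i j => (π ^ (i : ℕ)) (x j)) (fun j => ⟨x j, fun i => rfl⟩)
      fun i => hx i
    have h0 := hc ⟨0, by omega⟩
    have h1 := hc ⟨1, hp⟩
    simp only [pow_zero, Equiv.Perm.one_apply, pow_one] at h0 h1
    rw [h1, ← h0]
  · intro H M hM hD
    choose x hx using hM
    have hx' : ∀ i : Fin p, M i = fun j => (π ^ (i : ℕ)) (x j) := fun i => funext fun j => hx j i
    have hD' : ∀ i : ℕ, D fun j => (π ^ i) (x j) := fun i => by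
      have := hD ⟨i % p, Nat.mod_lt _ (by omega)⟩
      rw [hx'] at this
      rwa [pow_eq_pow_mod i h1]
    have key : ∀ i : ℕ, G (fun j => (π ^ i) (x j)) = (π ^ i) (G x) := by
      intro i
      induction i with
      | zero => rfl
      | succ i ih =>
        have := H (fun j => (π ^ i) (x j)) fun l => by
          simpa only [← Equiv.Perm.mul_apply, ← pow_add] using hD' (l + i)
        simp only [pow_succ', Equiv.Perm.mul_apply]
        rw [this, ih]
    exact ⟨G x, fun i => (congrArg G (hx' i)).trans (key i)⟩

theorem ternary_mem_pPol_cycleRel (hp : 1 < p) (hπ : ∀ x, Function.minimalPeriod π x = p)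
    {D : A → A → A → Prop} {G : A → A → A → A}
    (h : ∀ u v w, (∀ i : ℕ, D ((π ^ i) u) ((π ^ i) v) ((π ^ i) w)) →
      G (π u) (π v) (π w) = π (G u v w)) : ternary D G ∈ pPol (cycleRel p π) :=
  (restrict_mem_pPol_cycleRel hp hπ).2 fun x hx =>
    h (x (0 : Fin 3)) (x (1 : Fin 3)) (x (2 : Fin 3)) hx

/-- If equivariance fails on the orbit of x, the phase of one argument y can drive that orbit: the
total function F(π^τ(y) x) never maps a column of the relation into the relation. Hence the
condition on the target is vacuous. -/
theorem isMaximalPartialClone_pPol_cycleRel [Finite A] [Nonempty A] (hp : 1 < p)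
    (hπ : ∀ x, Function.minimalPeriod π x = p) :
    IsMaximalPartialClone (pPol (cycleRel p π)) := by
  have h1 := pow_eq_one_of_minimalPeriod hπ
  refine isMaximalPartialClone_of (isPartialClone_pPol _) ?_ ?_
  · obtain ⟨a⟩ := ‹Nonempty A›
    refine ⟨⟨1, restrict (fun _ => True) fun _ => a⟩, fun hmem => ?_⟩
    have h := (restrict_mem_pPol_cycleRel hp hπ).1 hmem (fun _ => a) fun _ => trivial
    have h2 : Function.minimalPeriod π a = 1 :=
      Function.minimalPeriod_eq_one_iff_isFixedPt.2 h.symm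
    rw [hπ] at h2
    omega
  · intro C' hC' hsub f hf' hf g
    obtain ⟨n, f⟩ := f
    obtain ⟨m, g⟩ := g
    obtain ⟨D, F, rfl⟩ := exists_eq_restrict f
    obtain ⟨E, G, rfl⟩ := exists_eq_restrict g
    rw [restrict_mem_pPol_cycleRel hp hπ] at hf
    push Not at hf
    obtain ⟨x, hx, hne⟩ := hf
    obtain ⟨τ, hτ⟩ := exists_phase (by omega) hπ
    let i₀ : Fin m := ⟨0, m.pos⟩
    refine hC'.restrict_mem_of_pPol_subset hsub (q := 1)
      (fun _ y => F fun j => (π ^ τ (y i₀)) (x j)) (fun _ => ?_) ?_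
    · have hu : ∀ j, (⟨m, restrict (fun _ => True) fun y => (π ^ τ (y i₀)) (x j)⟩ : Par A) ∈ C' := by
        refine fun j => hsub ((restrict_mem_pPol_cycleRel hp hπ).2 fun y _ => ?_)
        rw [hτ, pow_succ', Equiv.Perm.mul_apply]
      have key := hC'.restrict_comp_mem hf' hu
      convert key using 3
      simp [hx]
    · intro M hM hs _
      obtain ⟨y, hy⟩ := hM i₀
      obtain ⟨c, hc⟩ := hs 0
      have hc' : ∀ i : ℕ, F (fun j => (π ^ (i + τ y)) (x j)) = (π ^ i) c := by
        have hτ' : ∀ i : ℕ, π ^ τ ((π ^ i) y) = π ^ (i + τ y) := by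
          intro i
          induction i with
          | zero => simp
          | succ i ih =>
            rw [pow_succ' π i, Equiv.Perm.mul_apply, hτ, pow_succ, ih, ← pow_succ]
            congr 1
            omega
        intro i
        have := hc ⟨i % p, Nat.mod_lt _ (by omega)⟩
        simp only [hy, ← pow_eq_pow_mod i h1, hτ'] at this
        exact this
      refine absurd ?_ hne
      -- Advancing by (p - 1) τ(y) cancels the phase of y and brings the orbit back to x itself.
      have e : π ^ ((p - 1) * τ y + τ y) = 1 := by
        rw [← Nat.succ_mul, Nat.succ_eq_add_one, Nat.sub_add_cancel (by omega), pow_mul, h1,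
          one_pow]
      have ha := hc' ((p - 1) * τ y)
      have hb := hc' ((p - 1) * τ y + 1)
      rw [e] at ha
      rw [add_right_comm, pow_succ', e, pow_succ', Equiv.Perm.mul_apply, ← ha] at hb
      exact hb

/-- Constants are not equivariant, so truth values are encoded relative to x i₀: the value x i₀
means true and π (x i₀) means false. Each conjunct costs one ternary function. -/
theorem restrict_selector_mem (hp : 1 < p) (hπ : ∀ x, Function.minimalPeriod π x = p)
    [DecidableEq A] {C : Set (Par A)} (hC : IsPartialClone C)
    (hter : ∀ D G, ternary D G ∈ pPol (cycleRel p π) → ternary D G ∈ C) {m : ℕ+} (i₀ : Fin m)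
    {h : Fin m → A → A} (hh : ∀ j z, h j (π z) = π (h j z)) (S : Finset (Fin m)) :
    (⟨m, restrict (fun _ => True) fun x =>
      if ∀ j ∈ S, x j = h j (x i₀) then x i₀ else π (x i₀)⟩ : Par A) ∈ C := by
  induction S using Finset.induction_on with
  | empty => simpa using hC.restrict_proj_mem i₀
  | insert j S _ ih =>
    have hV : ternary (fun _ _ _ => True) (fun u v s => if v = h j u then s else π u) ∈ C :=
      hter _ _ (ternary_mem_pPol_cycleRel hp hπ fun u v w _ => by
        simp only [hh, π.injective.eq_iff]
        split_ifs <;> rfl)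
    have key := hC.ternary_comp_total_mem hV (hC.restrict_proj_mem i₀) (hC.restrict_proj_mem j) ih
    convert key using 4 with x
    simp only [Finset.forall_mem_insert]
    split_ifs <;> simp_all

/-- By `exists_equivariant` every tuple x has the form h(x i₀) with h equivariant. On the tuples
belonging to one h, G depends on x i₀ alone, and the finitely many h are glued one at a time. -/
theorem restrict_mem_of_ternary_cycleRel [Finite A] (hp : 1 < p)
    (hπ : ∀ x, Function.minimalPeriod π x = p)
    {C : Set (Par A)} (hC : IsPartialClone C)
    (hter : ∀ D G, ternary D G ∈ pPol (cycleRel p π) → ternary D G ∈ C) {m : ℕ+}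
    {D : (Fin m → A) → Prop} {G : (Fin m → A) → A}
    (hG : (⟨m, restrict D G⟩ : Par A) ∈ pPol (cycleRel p π)) :
    (⟨m, restrict D G⟩ : Par A) ∈ C := by
  classical
  have := Fintype.ofFinite A
  let i₀ : Fin m := ⟨0, m.pos⟩
  have hfix : ∀ u : A, π u ≠ u := fun u hu => by
    have h2 : Function.minimalPeriod π u = 1 := Function.minimalPeriod_eq_one_iff_isFixedPt.2 hu
    rw [hπ] at h2
    omega
  rw [restrict_mem_pPol_cycleRel hp hπ] at hG
  have main : ∀ S : Finset (Fin m → A → A), (∀ h ∈ S, ∀ j z, h j (π z) = π (h j z)) →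
      (⟨m, restrict (fun x => (∃ h ∈ S, ∀ j, x j = h j (x i₀)) → D x) fun x =>
        if ∃ h ∈ S, ∀ j, x j = h j (x i₀) then G x else x i₀⟩ : Par A) ∈ C := by
    intro S
    induction S using Finset.induction_on with
    | empty => intro _; simpa using hC.restrict_proj_mem i₀
    | insert h S _ ih =>
      intro hS
      rw [Finset.forall_mem_insert] at hS
      obtain ⟨hh, hS⟩ := hS
      -- Here s is the selector for h: if s = u the tuple belongs to h, and both domain and value
      -- are prescribed; otherwise the earlier value y passes through.
      have hW : ternary (fun u s _ => s = u → D fun j => h j u)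
          (fun u s y => if s = u then G (fun j => h j u) else y) ∈ C :=
        hter _ _ (ternary_mem_pPol_cycleRel hp hπ fun u s y hD => by
          simp only [hh, π.injective.eq_iff]
          split_ifs with hsu
          · refine hG _ fun i => ?_
            have e : ∀ j, (π ^ i) (h j u) = h j ((π ^ i) u) := by
              intro j
              induction i with
              | zero => rfl
              | succ i ih => rw [pow_succ', Equiv.Perm.mul_apply, Equiv.Perm.mul_apply, hh, ih]
            simp only [e]
            exact hD i (by rw [hsu])
          · rfl)
      have key := hC.ternary_comp_mem hW (hC.restrict_proj_mem i₀)
        (restrict_selector_mem hp hπ hC hter i₀ hh Finset.univ) (ih hS)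
      convert key using 2
      have hx : ∀ x : Fin m → A, ((if ∀ j ∈ Finset.univ, x j = h j (x i₀) then x i₀
          else π (x i₀)) = x i₀) ↔ ∀ j, x j = h j (x i₀) := by
        intro x
        split_ifs with hc
        · simpa using hc
        · simpa [hfix] using hc
      refine restrict_congr (fun x => ?_) fun x _ => ?_
      · simp only [hx, Finset.exists_mem_insert, true_and]
        constructor
        · intro hD
          refine ⟨fun h' => hD (Or.inr h'), fun h' => ?_⟩
          rw [← funext h']
          exact hD (Or.inl h')
        · rintro ⟨hD, hD'⟩ (h' | h')
          · rw [funext h']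
            exact hD' h'
          · exact hD h'
      · simp only [hx, Finset.exists_mem_insert]
        by_cases h' : ∀ j, x j = h j (x i₀)
        · rw [if_pos (Or.inl h'), if_pos h', ← funext h']
        · simp only [h', false_or, if_false]
  have key := main (Finset.univ.filter fun h => ∀ j z, h j (π z) = π (h j z))
    fun h hh => (Finset.mem_filter.1 hh).2
  have hex : ∀ x : Fin m → A, ∃ h ∈ Finset.univ.filter (fun h : Fin m → A → A =>
      ∀ j z, h j (π z) = π (h j z)), ∀ j, x j = h j (x i₀) := by
    intro x
    choose h hh hx using fun j => exists_equivariant (by omega) hπ (x i₀) (x j)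
    exact ⟨h, by simpa using hh, fun j => (hx j).symm⟩
  simpa only [hex, if_true, true_imp_iff] using key

theorem isFinitelyGenerated_pPol_cycleRel [Finite A] [Nonempty A] (hp : 1 < p)
    (hπ : ∀ x, Function.minimalPeriod π x = p) :
    IsFinitelyGenerated (pPol (cycleRel p π)) := by
  refine isFinitelyGenerated_of_ternary (isPartialClone_pPol _) fun C hC hter f hf => ?_
  obtain ⟨m, f⟩ := f
  obtain ⟨D, G, rfl⟩ := exists_eq_restrict f
  exact restrict_mem_of_ternary_cycleRel hp hπ hC hter hf

end Cycle

/-! ### The clone of a linear order -/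

section Order

variable [LinearOrder A]

theorem restrict_mem_pPol_le {n : ℕ+} {D : (Fin n → A) → Prop} {G : (Fin n → A) → A} :
    (⟨n, restrict D G⟩ : Par A) ∈ pPol (binRel ((· ≤ ·) : A → A → Prop)) ↔
      ∀ x y : Fin n → A, D x → D y → x ≤ y → G x ≤ G y := by
  rw [restrict_mem_pPol]
  constructor
  · intro H x y hx hy hxy
    exact H ![x, y] (fun j => hxy j) (Fin.forall_fin_two.2 ⟨hx, hy⟩)
  · intro H M hM hD
    exact H (M 0) (M 1) (hD 0) (hD 1) fun j => hM j

theorem ternary_mem_pPol_le {D : A → A → A → Prop} {G : A → A → A → A}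
    (h : ∀ u v w u' v' w', D u v w → D u' v' w' → u ≤ u' → v ≤ v' → w ≤ w' →
      G u v w ≤ G u' v' w') : ternary D G ∈ pPol (binRel ((· ≤ ·) : A → A → Prop)) :=
  restrict_mem_pPol_le.2 fun _ _ hx hy hxy =>
    h _ _ _ _ _ _ hx hy (hxy (0 : Fin 3)) (hxy (1 : Fin 3)) (hxy (2 : Fin 3))

/-- Take x ≤ y in the domain with F y < F x. Feeding F the monotone thresholds "y if a ≤ z i, else
x" gives total order-reversing indicators. Comparable rows on which all of them are also
order-preserving must coincide. -/
theorem isMaximalPartialClone_pPol_le [Finite A] [Nontrivial A] :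
    IsMaximalPartialClone (pPol (binRel ((· ≤ ·) : A → A → Prop))) := by
  have := Fintype.ofFinite A
  refine isMaximalPartialClone_of (isPartialClone_pPol _) ?_ ?_
  · obtain ⟨a, b, hab⟩ := exists_pair_lt A
    refine ⟨⟨1, restrict (fun _ => True) fun x => if x (0 : Fin 1) = a then b else a⟩,
      fun hmem => ?_⟩
    have h := restrict_mem_pPol_le.1 hmem (fun _ => a) (fun _ => b) trivial trivial
      fun _ => hab.le
    simp [hab.ne'] at h
    exact absurd hab h.not_gt
  · intro C' hC' hsub f hf' hf g
    obtain ⟨n, f⟩ := f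
    obtain ⟨m, g⟩ := g
    obtain ⟨D, F, rfl⟩ := exists_eq_restrict f
    obtain ⟨E, G, rfl⟩ := exists_eq_restrict g
    rw [restrict_mem_pPol_le] at hf
    push Not at hf
    obtain ⟨x, y, hx, hy, hxy, hlt⟩ := hf
    let e := (Fintype.equivFin (Fin m × A)).symm
    let u : Fin m × A → (Fin m → A) → Fin n → A := fun c z => if c.2 ≤ z c.1 then y else x
    have hu : ∀ c z, D (u c z) := by
      intro c z
      simp only [u]
      split_ifs
      exacts [hy, hx]
    refine hC'.restrict_mem_of_pPol_subset hsub (fun l z => F (u (e l) z)) (fun l => ?_) ?_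
    · have hmem : ∀ j, (⟨m, restrict (fun _ => True) fun z => u (e l) z j⟩ : Par A) ∈ C' := by
        refine fun j => hsub (restrict_mem_pPol_le.2 fun z z' _ _ hz => ?_)
        simp only [u]
        split_ifs with h1 h2
        · exact le_rfl
        · exact absurd (h1.trans (hz _)) h2
        · exact hxy j
        · exact le_rfl
      have key := hC'.restrict_comp_mem hf' hmem
      convert key using 3
      simp [hu]
    · intro M hM hs _
      have hle : ∀ j, M 0 j ≤ M 1 j := hM
      have e0 : M 0 = M 1 := by
        funext j
        refine (hle j).antisymm (not_lt.1 fun hj => ?_)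
        -- The threshold at the larger entry M 1 j separates the two rows.
        have h : F (u (e (e.symm (j, M 1 j))) (M 0)) ≤ F (u (e (e.symm (j, M 1 j))) (M 1)) :=
          hs (e.symm (j, M 1 j))
        rw [Equiv.apply_symm_apply] at h
        simp only [u, le_refl, if_true, if_neg hj.not_ge] at h
        exact absurd h hlt.not_ge
      change G (M 0) ≤ G (M 1)
      rw [e0]

section

variable {C : Set (Par A)} {m : ℕ+}

theorem restrict_const_mem (hC : IsPartialClone C)
    (hter : ∀ D G, ternary D G ∈ pPol (binRel ((· ≤ ·) : A → A → Prop)) → ternary D G ∈ C)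
    (c : A) : (⟨m, restrict (fun _ => True) fun _ => c⟩ : Par A) ∈ C := by
  have h : ternary (fun _ _ _ => True) (fun _ _ _ => c) ∈ C :=
    hter _ _ (ternary_mem_pPol_le fun _ _ _ _ _ _ _ _ _ _ _ => le_rfl)
  have i := hC.restrict_proj_mem (⟨0, m.pos⟩ : Fin m)
  exact hC.ternary_comp_total_mem h i i i

variable [BoundedOrder A]

/-- Together with `restrict_not_le_mem` this recognises a single point: x = a exactly when this
indicator is ⊤ and the other is ⊥. -/
theorem restrict_ge_mem (hC : IsPartialClone C)
    (hter : ∀ D G, ternary D G ∈ pPol (binRel ((· ≤ ·) : A → A → Prop)) → ternary D G ∈ C)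
    (a : Fin m → A) (S : Finset (Fin m)) :
    (⟨m, restrict (fun _ => True) fun x => if ∀ j ∈ S, a j ≤ x j then ⊤ else ⊥⟩ : Par A) ∈ C := by
  induction S using Finset.induction_on with
  | empty => simpa using restrict_const_mem hC hter ⊤
  | insert j S _ ih =>
    have hV : ternary (fun _ _ _ => True) (fun u s _ => if a j ≤ u then s else ⊥) ∈ C :=
      hter _ _ (ternary_mem_pPol_le fun u v w u' v' w' _ _ hu hv _ => by
        split_ifs with h1 h2
        · exact hv
        · exact absurd (h1.trans hu) h2
        · exact bot_le
        · exact le_rfl)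
    have key := hC.ternary_comp_total_mem hV (hC.restrict_proj_mem j) ih ih
    convert key using 4 with x
    simp only [Finset.forall_mem_insert, ite_and]

theorem restrict_not_le_mem (hC : IsPartialClone C)
    (hter : ∀ D G, ternary D G ∈ pPol (binRel ((· ≤ ·) : A → A → Prop)) → ternary D G ∈ C)
    (a : Fin m → A) (S : Finset (Fin m)) :
    (⟨m, restrict (fun _ => True) fun x => if ∀ j ∈ S, x j ≤ a j then ⊥ else ⊤⟩ : Par A) ∈ C := by
  induction S using Finset.induction_on with
  | empty => simpa using restrict_const_mem hC hter ⊥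
  | insert j S _ ih =>
    have hV : ternary (fun _ _ _ => True) (fun u s _ => if u ≤ a j then s else ⊤) ∈ C :=
      hter _ _ (ternary_mem_pPol_le fun u v w u' v' w' _ _ hu hv _ => by
        split_ifs with h1 h2
        · exact hv
        · exact le_top
        · exact absurd (hu.trans ‹_›) h1
        · exact le_rfl)
    have key := hC.ternary_comp_total_mem hV (hC.restrict_proj_mem j) ih ih
    convert key using 4 with x
    simp only [Finset.forall_mem_insert, ite_and]

variable [Nontrivial A]

-- The supremum over points of S below x is monotone for any G; it serves as a total extension of a
-- partial monotone function.
open Classical in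
theorem restrict_sup_mem (hC : IsPartialClone C)
    (hter : ∀ D G, ternary D G ∈ pPol (binRel ((· ≤ ·) : A → A → Prop)) → ternary D G ∈ C)
    (G : (Fin m → A) → A) (S : Finset (Fin m → A)) :
    (⟨m, restrict (fun _ => True) fun x => (S.filter (· ≤ x)).sup G⟩ : Par A) ∈ C := by
  induction S using Finset.induction_on with
  | empty => simpa using restrict_const_mem hC hter ⊥
  | insert a S _ ih =>
    have hV : ternary (fun _ _ _ => True) (fun y s _ => if s = ⊤ then max (G a) y else y) ∈ C :=
      hter _ _ (ternary_mem_pPol_le fun u v w u' v' w' _ _ hu hv _ => by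
        split_ifs with h1 h2
        · exact max_le_max le_rfl hu
        · exact absurd (top_le_iff.1 (h1 ▸ hv)) h2
        · exact hu.trans (le_max_right _ _)
        · exact hu)
    have key := hC.ternary_comp_total_mem hV ih (restrict_ge_mem hC hter a Finset.univ) ih
    convert key using 4 with x
    rw [Finset.filter_insert]
    by_cases h : a ≤ x
    · rw [if_pos h, if_pos (fun j _ => h j), if_pos rfl, Finset.sup_insert]
    · have h' : ¬ ∀ j ∈ Finset.univ, a j ≤ x j := fun h' => h fun j => h' j (Finset.mem_univ j)
      rw [if_neg h, if_neg h', if_neg bot_ne_top]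

/-- Points are deleted one by one by a partial projection undefined when the two indicators of a are
⊤ and ⊥. -/
theorem restrict_notMem_mem (hC : IsPartialClone C)
    (hter : ∀ D G, ternary D G ∈ pPol (binRel ((· ≤ ·) : A → A → Prop)) → ternary D G ∈ C)
    {G : (Fin m → A) → A} (hG : (⟨m, restrict (fun _ => True) G⟩ : Par A) ∈ C)
    (S : Finset (Fin m → A)) : (⟨m, restrict (fun x => x ∉ S) G⟩ : Par A) ∈ C := by
  induction S using Finset.induction_on with
  | empty => simpa using hG
  | insert a S _ ih =>
    have hV : ternary (fun s t _ => ¬ (s = ⊤ ∧ t = ⊥)) (fun _ _ y => y) ∈ C :=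
      hter _ _ (ternary_mem_pPol_le fun _ _ _ _ _ _ _ _ _ _ h => h)
    have key := hC.ternary_comp_mem hV (restrict_ge_mem hC hter a Finset.univ)
      (restrict_not_le_mem hC hter a Finset.univ) ih
    convert key using 2
    refine restrict_congr (fun x => ?_) fun _ _ => rfl
    have e1 : ((if ∀ j ∈ Finset.univ, a j ≤ x j then ⊤ else ⊥ : A) = ⊤) ↔ a ≤ x := by
      simp [Pi.le_def]
    have e2 : ((if ∀ j ∈ Finset.univ, x j ≤ a j then ⊥ else ⊤ : A) = ⊥) ↔ x ≤ a := by
      simp [Pi.le_def]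
    rw [e1, e2, ← le_antisymm_iff, Finset.mem_insert, eq_comm (a := a)]
    tauto

theorem restrict_mem_of_ternary_le [Finite A] (hC : IsPartialClone C)
    (hter : ∀ D G, ternary D G ∈ pPol (binRel ((· ≤ ·) : A → A → Prop)) → ternary D G ∈ C)
    {D : (Fin m → A) → Prop} {G : (Fin m → A) → A}
    (hG : (⟨m, restrict D G⟩ : Par A) ∈ pPol (binRel ((· ≤ ·) : A → A → Prop))) :
    (⟨m, restrict D G⟩ : Par A) ∈ C := by
  classical
  have := Fintype.ofFinite A
  rw [restrict_mem_pPol_le] at hG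
  have key := restrict_notMem_mem hC hter
    (restrict_sup_mem hC hter G (Finset.univ.filter D)) (Finset.univ.filter fun x => ¬ D x)
  convert key using 2
  refine restrict_congr (fun x => by simp) fun x hx => ?_
  refine le_antisymm (Finset.le_sup (f := G) (b := x) (by simpa using hx))
    (Finset.sup_le fun y hy => ?_)
  simp only [Finset.mem_filter, Finset.mem_univ, true_and] at hy
  exact hG y x hy.1 hx hy.2

end

theorem isFinitelyGenerated_pPol_le [Finite A] [Nontrivial A] :
    IsFinitelyGenerated (pPol (binRel ((· ≤ ·) : A → A → Prop))) := by
  have := Fintype.ofFinite A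
  have := Fintype.toBoundedOrder A
  refine isFinitelyGenerated_of_ternary (isPartialClone_pPol _) fun C hC hter f hf => ?_
  obtain ⟨m, f⟩ := f
  obtain ⟨D, G, rfl⟩ := exists_eq_restrict f
  exact restrict_mem_of_ternary_le hC hter hf

end Order

/-! ### Monotone operations commuting with the block rotation -/

section Rotation

variable {q s : ℕ}

/-- The rotation by `c` inside each block of `Fin q ×ₗ Fin (s + 2)`. -/
def rot (c : Fin (s + 2)) (x : Fin q ×ₗ Fin (s + 2)) : Fin q ×ₗ Fin (s + 2) :=
  toLex ((ofLex x).1, (ofLex x).2 + c)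

theorem toLex_le_iff {b b' : Fin q} {i i' : Fin (s + 2)} :
    (toLex (b, i) : Fin q ×ₗ Fin (s + 2)) ≤ toLex (b', i') ↔ b < b' ∨ b = b' ∧ i ≤ i' :=
  Prod.Lex.toLex_le_toLex

theorem exists_eq_toLex (x : Fin q ×ₗ Fin (s + 2)) : ∃ b i, x = toLex (b, i) :=
  ⟨(ofLex x).1, (ofLex x).2, rfl⟩

theorem le_neg_one (i : Fin (s + 2)) : i ≤ -1 := by
  rw [← Fin.last_add_one (s + 1) |> eq_neg_of_add_eq_zero_left]
  exact Fin.le_last i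

theorem neg_one_le_iff {i : Fin (s + 2)} : -1 ≤ i ↔ i = -1 :=
  ⟨fun h => (le_neg_one i).antisymm h, fun h => h.ge⟩

theorem zero_ne_neg_one : (0 : Fin (s + 2)) ≠ -1 := by
  rw [Ne, eq_comm, neg_eq_zero]
  exact one_ne_zero

theorem le_one_iff {i : Fin (s + 2)} : i ≤ 1 ↔ i = 0 ∨ i = 1 := by
  simp only [Fin.le_def, Fin.ext_iff, Fin.val_zero, Fin.val_one]
  omega

theorem toLex_inj {b b' : Fin q} {i i' : Fin (s + 2)} :
    (toLex (b, i) : Fin q ×ₗ Fin (s + 2)) = toLex (b', i') ↔ b = b' ∧ i = i' := by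
  rw [toLex.injective.eq_iff, Prod.mk_inj]

/-- A monotone function commuting with the rotation is the identity. -/
theorem eq_self_of_monotone_of_rot {u : Fin q ×ₗ Fin (s + 2) → Fin q ×ₗ Fin (s + 2)}
    (hm : Monotone u) (hr : ∀ c x, u (rot c x) = rot c (u x)) (x) : u x = x := by
  have h : ∀ b : Fin q, ∃ β : Fin q, ∀ i, u (toLex (b, i)) = toLex (β, i) := by
    intro b
    obtain ⟨β, j, hj⟩ := exists_eq_toLex (u (toLex (b, 0)))
    have h1 : ∀ i, u (toLex (b, i)) = toLex (β, j + i) := fun i => by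
      have := hr i (toLex (b, 0))
      rw [hj] at this
      simpa [rot] using this
    -- The position -j is chosen because its image has position 0, while the image of position 0 has
    -- position j; monotonicity then forces j = 0.
    have h2 := hm (toLex_le_iff.2 (Or.inr ⟨rfl, Fin.zero_le (-j)⟩) :
      (toLex (b, 0) : Fin q ×ₗ Fin (s + 2)) ≤ toLex (b, -j))
    rw [h1, h1, toLex_le_iff] at h2
    simp only [lt_irrefl, false_or, true_and, add_zero, add_neg_cancel, Fin.le_zero_iff] at h2
    exact ⟨β, fun i => by rw [h1, h2, zero_add]⟩
  choose β hβ using h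
  have hmono : StrictMono β := by
    intro b b' hb
    have h2 := hm (toLex_le_iff.2 (Or.inl hb) :
      (toLex (b, -1) : Fin q ×ₗ Fin (s + 2)) ≤ toLex (b', 0))
    rw [hβ, hβ, toLex_le_iff] at h2
    rcases h2 with h2 | ⟨-, h2⟩
    · exact h2
    · exact absurd (neg_one_le_iff.1 h2) zero_ne_neg_one
  obtain ⟨b, i, rfl⟩ := exists_eq_toLex x
  have e : β b = b := by
    have h1 : b ≤ β b := hmono.le_apply
    have h2 : β b ≤ b := hmono.dual.le_apply (x := OrderDual.toDual b)
    exact h2.antisymm h1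
  rw [hβ, e]

/-- The value at positions (1, 0) lies between 0 and 1. Rotating by -1 makes the value at (0, -1)
either -1 or 0, an extreme position; monotonicity spreads it along one argument, and rotation to the
whole block. -/
theorem proj_on_block
    {g : Fin q ×ₗ Fin (s + 2) → Fin q ×ₗ Fin (s + 2) → Fin q ×ₗ Fin (s + 2)}
    (hm : ∀ {x x' y y'}, x ≤ x' → y ≤ y' → g x y ≤ g x' y')
    (hr : ∀ c x y, g (rot c x) (rot c y) = rot c (g x y)) (hi : ∀ x, g x x = x)
    (b : Fin q) :
    (∀ i j, g (toLex (b, i)) (toLex (b, j)) = toLex (b, i)) ∨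
      ∀ i j, g (toLex (b, i)) (toLex (b, j)) = toLex (b, j) := by
  have hle : ∀ {i j : Fin (s + 2)}, i ≤ j →
      (toLex (b, i) : Fin q ×ₗ Fin (s + 2)) ≤ toLex (b, j) :=
    fun h => toLex_le_iff.2 (Or.inr ⟨rfl, h⟩)
  obtain ⟨c, k, hv⟩ := exists_eq_toLex (g (toLex (b, 1)) (toLex (b, 0)))
  have h0 : (toLex (b, 0) : Fin q ×ₗ Fin (s + 2)) ≤ toLex (c, k) := by
    rw [← hv]
    conv_lhs => rw [← hi (toLex (b, 0))]
    exact hm (hle (Fin.zero_le _)) le_rfl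
  have h1 : (toLex (c, k) : Fin q ×ₗ Fin (s + 2)) ≤ toLex (b, 1) := by
    rw [← hv]
    conv_rhs => rw [← hi (toLex (b, 1))]
    exact hm le_rfl (hle (Fin.zero_le _))
  rw [toLex_le_iff] at h0 h1
  have hcb : c = b := by
    rcases h0 with h0 | h0
    · rcases h1 with h1 | h1
      · exact absurd h0 h1.not_gt
      · exact h1.1
    · exact h0.1.symm
  subst hcb
  have hk : k = 0 ∨ k = 1 := le_one_iff.1 (by simpa using h1)
  have h2 : g (toLex (c, 0)) (toLex (c, -1)) = toLex (c, k - 1) := by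
    have := hr (-1) (toLex (c, 1)) (toLex (c, 0))
    rw [hv] at this
    simpa [rot, sub_eq_add_neg] using this
  rcases hk with rfl | rfl
  · right
    have h3 : ∀ i, g (toLex (c, i)) (toLex (c, -1)) = toLex (c, -1) := by
      intro i
      refine le_antisymm ?_ ?_
      · conv_rhs => rw [← hi (toLex (c, -1))]
        exact hm (hle (le_neg_one i)) le_rfl
      · rw [zero_sub] at h2
        conv_lhs => rw [← h2]
        exact hm (hle (Fin.zero_le i)) le_rfl
    intro i j
    have := hr (j + 1) (toLex (c, i - (j + 1))) (toLex (c, -1))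
    rw [h3] at this
    simpa [rot] using this
  · left
    have h3 : ∀ j, g (toLex (c, 0)) (toLex (c, j)) = toLex (c, 0) := by
      intro j
      refine le_antisymm ?_ ?_
      · rw [sub_self] at h2
        conv_rhs => rw [← h2]
        exact hm le_rfl (hle (le_neg_one j))
      · conv_lhs => rw [← hi (toLex (c, 0))]
        exact hm le_rfl (hle (Fin.zero_le j))
    intro i j
    have := hr i (toLex (c, 0)) (toLex (c, j - i))
    rw [h3] at this
    simpa [rot] using this

/-- With the first argument in b' and the second in b, the values are squeezed between the
neighbours (b, -1) and (b', 0). Rotation by one moves either of them out of this pair. -/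
theorem not_proj_change
    {g : Fin q ×ₗ Fin (s + 2) → Fin q ×ₗ Fin (s + 2) → Fin q ×ₗ Fin (s + 2)}
    (hm : ∀ {x x' y y'}, x ≤ x' → y ≤ y' → g x y ≤ g x' y')
    (hr : ∀ c x y, g (rot c x) (rot c y) = rot c (g x y))
    {b b' : Fin q} (hb : (b' : ℕ) = b + 1)
    (h1 : ∀ i j, g (toLex (b, i)) (toLex (b, j)) = toLex (b, i))
    (h2 : ∀ i j, g (toLex (b', i)) (toLex (b', j)) = toLex (b', j)) : False := by
  have hlt : b < b' := by rw [Fin.lt_def]; omega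
  have key : ∀ i j c k, g (toLex (b', i)) (toLex (b, j)) = toLex (c, k) →
      c = b ∧ k = -1 ∨ c = b' ∧ k = 0 := by
    intro i j c k hv
    have l1 : (toLex (b, -1) : Fin q ×ₗ Fin (s + 2)) ≤ toLex (c, k) := by
      rw [← hv, ← h1 (-1) j]
      exact hm (toLex_le_iff.2 (Or.inl hlt)) le_rfl
    have l2 : (toLex (c, k) : Fin q ×ₗ Fin (s + 2)) ≤ toLex (b', 0) := by
      rw [← hv, ← h2 i 0]
      exact hm le_rfl (toLex_le_iff.2 (Or.inl hlt))
    rw [toLex_le_iff] at l1 l2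
    rcases l1 with l1 | ⟨rfl, l1⟩
    · rcases l2 with l2 | ⟨rfl, l2⟩
      · rw [Fin.lt_def] at l1 l2
        omega
      · exact Or.inr ⟨rfl, Fin.le_zero_iff.1 l2⟩
    · exact Or.inl ⟨rfl, neg_one_le_iff.1 l1⟩
  obtain ⟨c, k, hv⟩ := exists_eq_toLex (g (toLex (b', 0)) (toLex (b, 0)))
  have hv' : g (toLex (b', 0 + 1)) (toLex (b, 0 + 1)) = toLex (c, k + 1) := by
    have := hr 1 (toLex (b', 0)) (toLex (b, 0))
    rw [hv] at this
    exact this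
  rcases key _ _ _ _ hv with ⟨rfl, rfl⟩ | ⟨rfl, rfl⟩
  · rcases key _ _ _ _ hv' with ⟨-, h⟩ | ⟨h, -⟩
    · rw [neg_add_cancel] at h
      exact zero_ne_neg_one h
    · exact hlt.ne h
  · rcases key _ _ _ _ hv' with ⟨h, -⟩ | ⟨-, h⟩
    · exact hlt.ne' h
    · rw [zero_add] at h
      exact one_ne_zero h

/-- Induction on the distance of the blocks. Idempotence bounds the value by x on one side, and the
induction hypothesis bounds it by the nearest point of the adjacent block on the other. That point
is excluded by rotating once; rotating x to the end of its block then fixes the position. -/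
theorem eq_fst_of_blocks
    {g : Fin q ×ₗ Fin (s + 2) → Fin q ×ₗ Fin (s + 2) → Fin q ×ₗ Fin (s + 2)}
    (hm : ∀ {x x' y y'}, x ≤ x' → y ≤ y' → g x y ≤ g x' y')
    (hr : ∀ c x y, g (rot c x) (rot c y) = rot c (g x y)) (hi : ∀ x, g x x = x)
    (h1 : ∀ b i j, g (toLex (b, i)) (toLex (b, j)) = toLex (b, i))
    (x y) : g x y = x := by
  have up : ∀ (d : ℕ) (b b' : Fin q), (b' : ℕ) = b + d →
      ∀ i j, g (toLex (b, i)) (toLex (b', j)) = toLex (b, i) := by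
    intro d
    induction d with
    | zero =>
      intro b b' hb
      obtain rfl : b' = b := Fin.ext hb
      exact h1 b'
    | succ d ih =>
      intro b b' hb i j
      let c₁ : Fin q := ⟨b + 1, by omega⟩
      have hc : b < c₁ := by rw [Fin.lt_def]; simp [c₁]
      have hbb : b < b' := by rw [Fin.lt_def]; omega
      have key : ∀ i j c k, g (toLex (b, i)) (toLex (b', j)) = toLex (c, k) →
          c = b ∧ i ≤ k ∨ c = c₁ ∧ k = 0 := by
        intro i j c k hv
        have l1 : (toLex (b, i) : Fin q ×ₗ Fin (s + 2)) ≤ toLex (c, k) := by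
          rw [← hv]
          conv_lhs => rw [← hi (toLex (b, i))]
          exact hm le_rfl (toLex_le_iff.2 (Or.inl hbb))
        have l2 : (toLex (c, k) : Fin q ×ₗ Fin (s + 2)) ≤ toLex (c₁, 0) := by
          rw [← hv, ← ih c₁ b' (by simp only [c₁]; omega) 0 j]
          exact hm (toLex_le_iff.2 (Or.inl hc)) le_rfl
        rw [toLex_le_iff] at l1 l2
        rcases l1 with l1 | ⟨rfl, l1⟩
        · rcases l2 with l2 | ⟨rfl, l2⟩
          · rw [Fin.lt_def] at l1 l2
            simp only [c₁] at l2
            omega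
          · exact Or.inr ⟨rfl, Fin.le_zero_iff.1 l2⟩
        · exact Or.inl ⟨rfl, l1⟩
      obtain ⟨c, k, hv⟩ := exists_eq_toLex (g (toLex (b, i)) (toLex (b', j)))
      have hv' : ∀ a, g (toLex (b, i + a)) (toLex (b', j + a)) = toLex (c, k + a) := by
        intro a
        have := hr a (toLex (b, i)) (toLex (b', j))
        rw [hv] at this
        exact this
      rcases key _ _ _ _ hv with ⟨rfl, -⟩ | ⟨rfl, rfl⟩
      · rcases key _ _ _ _ (hv' (-1 - i)) with ⟨-, h⟩ | ⟨h, -⟩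
        · rw [add_sub_cancel, neg_one_le_iff] at h
          rw [hv, toLex_inj]
          refine ⟨rfl, ?_⟩
          have : k + (-1 - i) + (1 + i) = -1 + (1 + i) := by rw [h]
          simpa [add_assoc, sub_eq_add_neg, add_left_comm] using this
        · exact absurd h hc.ne
      · rcases key _ _ _ _ (hv' 1) with ⟨h, -⟩ | ⟨-, h⟩
        · exact absurd h hc.ne'
        · rw [zero_add] at h
          exact absurd h one_ne_zero
  have down : ∀ (d : ℕ) (b b' : Fin q), (b : ℕ) = b' + d →
      ∀ i j, g (toLex (b, i)) (toLex (b', j)) = toLex (b, i) := by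
    intro d
    induction d with
    | zero =>
      intro b b' hb
      obtain rfl : b = b' := Fin.ext hb
      exact h1 b
    | succ d ih =>
      intro b b' hb i j
      let c₁ : Fin q := ⟨b - 1, by omega⟩
      have hc : c₁ < b := by rw [Fin.lt_def]; simp only [c₁]; omega
      have hbb : b' < b := by rw [Fin.lt_def]; omega
      have key : ∀ i j c k, g (toLex (b, i)) (toLex (b', j)) = toLex (c, k) →
          c = b ∧ k ≤ i ∨ c = c₁ ∧ k = -1 := by
        intro i j c k hv
        have l1 : (toLex (c, k) : Fin q ×ₗ Fin (s + 2)) ≤ toLex (b, i) := by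
          rw [← hv]
          conv_rhs => rw [← hi (toLex (b, i))]
          exact hm le_rfl (toLex_le_iff.2 (Or.inl hbb))
        have l2 : (toLex (c₁, -1) : Fin q ×ₗ Fin (s + 2)) ≤ toLex (c, k) := by
          rw [← hv, ← ih c₁ b' (by simp only [c₁]; omega) (-1) j]
          exact hm (toLex_le_iff.2 (Or.inl hc)) le_rfl
        rw [toLex_le_iff] at l1 l2
        rcases l1 with l1 | ⟨rfl, l1⟩
        · rcases l2 with l2 | ⟨rfl, l2⟩
          · rw [Fin.lt_def] at l1 l2
            simp only [c₁] at l2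
            omega
          · exact Or.inr ⟨rfl, neg_one_le_iff.1 l2⟩
        · exact Or.inl ⟨rfl, l1⟩
      obtain ⟨c, k, hv⟩ := exists_eq_toLex (g (toLex (b, i)) (toLex (b', j)))
      have hv' : ∀ a, g (toLex (b, i + a)) (toLex (b', j + a)) = toLex (c, k + a) := by
        intro a
        have := hr a (toLex (b, i)) (toLex (b', j))
        rw [hv] at this
        exact this
      rcases key _ _ _ _ hv with ⟨rfl, -⟩ | ⟨rfl, rfl⟩
      · rcases key _ _ _ _ (hv' (-i)) with ⟨-, h⟩ | ⟨h, -⟩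
        · rw [add_neg_cancel, Fin.le_zero_iff, add_neg_eq_zero] at h
          rw [hv, h]
        · exact absurd h hc.ne'
      · rcases key _ _ _ _ (hv' 1) with ⟨h, -⟩ | ⟨-, h⟩
        · exact absurd h hc.ne
        · rw [neg_add_cancel] at h
          exact absurd h zero_ne_neg_one
  obtain ⟨b, i, rfl⟩ := exists_eq_toLex x
  obtain ⟨b', j, rfl⟩ := exists_eq_toLex y
  rcases le_total (b : ℕ) b' with h | h
  · exact up (b' - b) b b' (by omega) i j
  · exact down (b - b') b b' (by omega) i j

theorem binary_eq_proj
    {g : Fin q ×ₗ Fin (s + 2) → Fin q ×ₗ Fin (s + 2) → Fin q ×ₗ Fin (s + 2)}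
    (hm : ∀ {x x' y y'}, x ≤ x' → y ≤ y' → g x y ≤ g x' y')
    (hr : ∀ c x y, g (rot c x) (rot c y) = rot c (g x y)) (hi : ∀ x, g x x = x) :
    (∀ x y, g x y = x) ∨ ∀ x y, g x y = y := by
  have hm' : ∀ {x x' y y'}, x ≤ x' → y ≤ y' → g y x ≤ g y' x' := fun h h' => hm h' h
  have hr' : ∀ c x y, g (rot c y) (rot c x) = rot c (g y x) := fun c x y => hr c y x
  rcases q with _ | t
  · exact Or.inl fun x => (ofLex x).1.elim0
  rcases proj_on_block hm hr hi 0 with h | h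
  · left
    refine eq_fst_of_blocks hm hr hi ?_
    rintro ⟨b, hb⟩
    induction b with
    | zero => exact h
    | succ b ih =>
      rcases proj_on_block hm hr hi ⟨b + 1, hb⟩ with h' | h'
      · exact h'
      · exact (not_proj_change hm hr rfl (ih (by omega)) h').elim
  · right
    suffices H : ∀ b i j, g (toLex (b, j)) (toLex (b, i)) = toLex (b, i) from
      fun x y => eq_fst_of_blocks (g := fun x y => g y x) hm' hr' hi H y x
    rintro ⟨b, hb⟩
    induction b with
    | zero => exact fun i j => h j i
    | succ b ih =>
      rcases proj_on_block hm hr hi ⟨b + 1, hb⟩ with h' | h'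
      · exact (not_proj_change (g := fun x y => g y x) hm' hr' rfl (ih (by omega))
          fun i j => h' j i).elim
      · exact fun i j => h' j i

/-- There is no majority operation that is monotone and commutes with the rotation. -/
theorem not_majority {t : ℕ} (hst : 1 ≤ s ∨ 1 ≤ t)
    {H : Fin (t + 1) ×ₗ Fin (s + 2) → Fin (t + 1) ×ₗ Fin (s + 2) → Fin (t + 1) ×ₗ Fin (s + 2) →
      Fin (t + 1) ×ₗ Fin (s + 2)}
    (hm : ∀ {x x' y y' z z'}, x ≤ x' → y ≤ y' → z ≤ z' → H x y z ≤ H x' y' z')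
    (hr : ∀ c x y z, H (rot c x) (rot c y) (rot c z) = rot c (H x y z))
    (h12 : ∀ x y, H x x y = x) (h13 : ∀ x y, H x y x = x) (h23 : ∀ x y, H x y y = y) :
    False := by
  -- A monotone majority operation on a chain is the median, but the rotation does not preserve
  -- betweenness. Two points are not enough for this, which is why `hst` is needed.
  have med1 : ∀ {a b c}, a ≤ b → b ≤ c → H a b c = b := fun {a b c} h h' =>
    le_antisymm ((hm le_rfl le_rfl le_rfl).trans ((hm h le_rfl le_rfl).trans (h12 b c).le))
      ((h23 a b).ge.trans (hm le_rfl le_rfl h'))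
  have med2 : ∀ {a b c}, c ≤ a → a ≤ b → H a b c = a := fun {a b c} h h' =>
    le_antisymm ((hm le_rfl le_rfl h).trans (h13 a b).le)
      ((h12 a c).ge.trans (hm le_rfl h' le_rfl))
  have med3 : ∀ {a b c}, b ≤ a → a ≤ c → H a b c = a := fun {a b c} h h' =>
    le_antisymm ((hm le_rfl h le_rfl).trans (h12 a c).le)
      ((h13 a b).ge.trans (hm le_rfl le_rfl h'))
  rcases hst with hs | ht
  · have e1 : H (toLex (0, 0)) (toLex (0, 1)) (toLex (0, -1)) = toLex (0, 1) :=
      med1 (toLex_le_iff.2 (Or.inr ⟨rfl, Fin.zero_le _⟩))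
        (toLex_le_iff.2 (Or.inr ⟨rfl, le_neg_one _⟩))
    have e2 : H (toLex (0, 0 + 1)) (toLex (0, 1 + 1)) (toLex (0, -1 + 1)) = toLex (0, 0 + 1) := by
      refine med2 (toLex_le_iff.2 (Or.inr ⟨rfl, ?_⟩)) (toLex_le_iff.2 (Or.inr ⟨rfl, ?_⟩))
      · rw [neg_add_cancel]
        exact Fin.zero_le _
      · obtain ⟨s, rfl⟩ : ∃ r, s = r + 1 := ⟨s - 1, by omega⟩
        rw [zero_add, Fin.le_def, Fin.val_add, Fin.val_one, Nat.mod_eq_of_lt (by omega)]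
        omega
    have := hr 1 (toLex (0, 0)) (toLex (0, 1)) (toLex (0, -1))
    rw [e1] at this
    have := (toLex_inj.1 (e2.symm.trans this)).2
    rw [add_left_inj] at this
    exact zero_ne_one this
  · have h01 : (0 : Fin (t + 1)) < Fin.last t := by
      rw [Fin.lt_def]
      exact ht
    have e1 : H (toLex (0, 0)) (toLex (0, -1)) (toLex (Fin.last t, 0)) = toLex (0, -1) :=
      med1 (toLex_le_iff.2 (Or.inr ⟨rfl, Fin.zero_le _⟩)) (toLex_le_iff.2 (Or.inl h01))
    have e2 : H (toLex (0, 0 + 1)) (toLex (0, -1 + 1)) (toLex (Fin.last t, 0 + 1)) =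
        toLex (0, 0 + 1) := by
      refine med3 (toLex_le_iff.2 (Or.inr ⟨rfl, ?_⟩)) (toLex_le_iff.2 (Or.inl h01))
      rw [neg_add_cancel]
      exact Fin.zero_le _
    have := hr 1 (toLex (0, 0)) (toLex (0, -1)) (toLex (Fin.last t, 0))
    rw [e1] at this
    have := (toLex_inj.1 (e2.symm.trans this)).2
    rw [add_left_inj] at this
    exact zero_ne_neg_one this

/-- A monotone operation that commutes with the rotation is a projection. -/
theorem exists_eq_proj {t n : ℕ} (hst : 1 ≤ s ∨ 1 ≤ t)
    {G : (Fin n → Fin (t + 1) ×ₗ Fin (s + 2)) → Fin (t + 1) ×ₗ Fin (s + 2)} (hm : Monotone G)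
    (hr : ∀ c x, G (fun j => rot c (x j)) = rot c (G x)) : ∃ j, ∀ x, G x = x j := by
  classical
  have hidem : ∀ c, G (fun _ => c) = c :=
    eq_self_of_monotone_of_rot (u := fun c => G fun _ => c) (fun _ _ h => hm fun _ => h)
      fun c x => hr c fun _ => x
  -- Call S decisive if a common value on S determines G. Splitting the arguments along S gives a
  -- binary operation, hence a projection, so S or its complement is decisive.
  let P : Finset (Fin n) → Prop := fun S => ∀ x c, (∀ i ∈ S, x i = c) → G x = c
  have hP : ∀ S, P S ∨ P Sᶜ := by
    intro S
    rcases binary_eq_proj (g := fun x y => G fun i => if i ∈ S then x else y)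
      (fun h h' => hm fun i => by dsimp only; split_ifs; exacts [h, h'])
      (fun c x y => by
        rw [← hr]
        congr 1
        funext i
        split_ifs <;> rfl)
      (fun x => by simpa using hidem x) with h | h
    · left
      intro x c hx
      refine le_antisymm ((hm fun i => ?_).trans (h c ⊤).le) ((h c ⊥).ge.trans (hm fun i => ?_))
      · by_cases hi : i ∈ S
        · simp [hi, hx i hi]
        · simp [hi]
      · by_cases hi : i ∈ S
        · simp [hi, hx i hi]
        · simp [hi]
    · right
      intro x c hx
      refine le_antisymm ((hm fun i => ?_).trans (h ⊤ c).le) ((h ⊥ c).ge.trans (hm fun i => ?_))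
      · by_cases hi : i ∈ S
        · simp [hi]
        · simp [hi, hx i (Finset.mem_compl.2 hi)]
      · by_cases hi : i ∈ S
        · simp [hi]
        · simp [hi, hx i (Finset.mem_compl.2 hi)]
  have huniv : P Finset.univ := fun x c hx => by
    have : x = fun _ => c := funext fun i => hx i (Finset.mem_univ i)
    rw [this, hidem]
  obtain ⟨S, hS⟩ := Set.Finite.exists_minimal (Set.toFinite {S | P S}) ⟨_, huniv⟩
  have hSP : P S := hS.prop
  have hne : S.Nonempty := by
    rw [Finset.nonempty_iff_ne_empty]
    rintro rfl
    have h1 := hSP (fun _ => toLex (0, 0)) (toLex (0, 0)) (by simp)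
    have h2 := hSP (fun _ => toLex (0, 0)) (toLex (0, 1)) (by simp)
    exact zero_ne_one (toLex_inj.1 (h1.symm.trans h2)).2
  obtain ⟨j, hj⟩ := hne
  by_cases h1 : P {j}
  · exact ⟨j, fun x => h1 x (x j) (by simp)⟩
  have h2 : ¬ P (S.erase j) := fun h2 => by
    have := hS.le_of_le h2 (Finset.erase_subset j S) hj
    simp at this
  have h1' := (hP _).resolve_left h1
  have h2' := (hP _).resolve_left h2
  -- For a minimal decisive S and j in S with {j} not decisive, the union of any two of {j}, S \ {j}
  -- and the complement of S is decisive. Identifying variables along this partition gives a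
  -- majority operation.
  refine (not_majority hst
    (H := fun x y z => G fun i => if i = j then x else if i ∈ S then y else z)
    (fun h h' h'' => hm fun i => by dsimp only; split_ifs; exacts [h, h', h''])
    (fun c x y z => ?_) (fun x y => ?_) (fun x y => ?_) fun x y => ?_).elim
  · rw [← hr]
    congr 1
    funext i
    split_ifs <;> rfl
  · refine hSP _ _ fun i hi => ?_
    simp [hi]
  · refine h2' _ _ fun i hi => ?_
    rw [Finset.mem_compl, Finset.mem_erase, not_and'] at hi
    by_cases h : i = j
    · simp [h]
    · have : i ∉ S := fun h' => hi h' h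
      simp [h, this]
  · refine h1' _ _ fun i hi => ?_
    rw [Finset.mem_compl, Finset.mem_singleton] at hi
    simp [hi]

end Rotation

/-! ### The intersection is not finitely generated -/

section NotFinitelyGenerated

variable [LinearOrder A] {s t : ℕ} {π : Equiv.Perm A}

/-- A total function in the intersection is a projection. -/
theorem exists_eq_proj_of_equiv (hst : 1 ≤ s ∨ 1 ≤ t) (E : Fin (t + 1) ×ₗ Fin (s + 2) ≃ A)
    (hE : ∀ x y, E x ≤ E y ↔ x ≤ y) (hπE : ∀ x, π (E x) = E (rot 1 x)) {n : ℕ}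
    {G : (Fin n → A) → A} (hm : Monotone G) (hr : ∀ x, G (fun j => π (x j)) = π (G x)) :
    ∃ j, ∀ x, G x = x j := by
  have h1 : ∀ x : Fin n → Fin (t + 1) ×ₗ Fin (s + 2),
      E.symm (G fun j => E (rot 1 (x j))) = rot 1 (E.symm (G fun j => E (x j))) := by
    intro x
    simp only [← hπE]
    rw [hr, Equiv.symm_apply_eq, ← hπE, Equiv.apply_symm_apply]
  have hc : ∀ (c : Fin (s + 2)) (x : Fin n → Fin (t + 1) ×ₗ Fin (s + 2)),
      E.symm (G fun j => E (rot c (x j))) = rot c (E.symm (G fun j => E (x j))) := by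
    intro c x
    induction c using Fin.induction with
    | zero => simp [rot]
    | succ c ih =>
      have hs : ∀ y : Fin (t + 1) ×ₗ Fin (s + 2), rot c.succ y = rot 1 (rot c.castSucc y) :=
        fun y => by simp [rot, add_assoc]
      simp only [hs]
      rw [h1, ih]
  obtain ⟨j, hj⟩ := exists_eq_proj hst (G := fun x => E.symm (G fun j => E (x j)))
    (fun x y h => by
      rw [← hE, Equiv.apply_symm_apply, Equiv.apply_symm_apply]
      exact hm fun j => (hE _ _).2 (h j))
    hc
  refine ⟨j, fun x => ?_⟩
  have := hj fun j => E.symm (x j)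
  simpa using this

/-- Points of `A ^ n` with at most `N` coordinates different from `z`. -/
def FewNe {n : ℕ} (z : A) (N : ℕ) (x : Fin n → A) : Prop :=
  (Finset.univ.filter fun j => x j ≠ z).card ≤ N

/-- The coordinate functions on the points with few coordinates different from `z`. -/
def coordRel (n : ℕ) (z : A) (N : ℕ) : Set ({x : Fin n → A // FewNe z N x} → A) :=
  {v | ∃ j, ∀ x, v x = x.1 j}

theorem mem_polOn_coordRel (hst : 1 ≤ s ∨ 1 ≤ t) (E : Fin (t + 1) ×ₗ Fin (s + 2) ≃ A)
    (hE : ∀ x y, E x ≤ E y ↔ x ≤ y) (hπE : ∀ x, π (E x) = E (rot 1 x))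
    (hπ : ∀ x, Function.minimalPeriod π x = s + 2) (z : A) {N : ℕ} (n : ℕ) {f : Par A}
    (hN : (f.1 : ℕ) ≤ N)
    (hf : f ∈ pPol (cycleRel (s + 2) π) ∩ pPol (binRel ((· ≤ ·) : A → A → Prop))) :
    f ∈ polOn (coordRel n z N) := by
  have : Nonempty A := ⟨z⟩
  obtain ⟨m, f⟩ := f
  obtain ⟨D, G, rfl⟩ := exists_eq_restrict f
  obtain ⟨hf1, hf2⟩ := hf
  rw [restrict_mem_pPol_cycleRel (by omega) hπ] at hf1
  rw [restrict_mem_pPol_le] at hf2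
  rw [restrict_mem_polOn]
  intro M hM hD
  choose j hj using hM
  have hM' : ∀ x, M x = fun l => x.1 (j l) := fun x => funext fun l => hj l x
  -- Only the at most N coordinates in the image of j matter; resetting the others to z yields a
  -- point of the index set without changing the row.
  have htotal : ∀ y : Fin n → A, D fun l => y (j l) := by
    intro y
    let x : Fin n → A := fun i => if i ∈ Finset.univ.image j then y i else z
    have hx : FewNe z N x := by
      refine le_trans (Finset.card_le_card (t := Finset.univ.image j) fun i hi => ?_)
        (Finset.card_image_le.trans ?_)
      · by_contra h
        simp only [Finset.mem_filter, x, if_neg h] at hi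
        exact hi.2 rfl
      · simpa using hN
    have := hD ⟨x, hx⟩
    rw [hM'] at this
    convert this using 2 with l
    simp [x]
  obtain ⟨i, hi⟩ := exists_eq_proj_of_equiv hst E hE hπE
      (G := fun y : Fin n → A => G fun l => y (j l))
    (fun y y' h => hf2 _ _ (htotal y) (htotal y') fun l => h (j l))
    (fun y => hf1 _ fun a => htotal fun l => (π ^ a) (y l))
  exact ⟨i, fun x => (congrArg G (hM' x)).trans (hi x.1)⟩

/-- Each coordinate differs from z in x or in π x, since π z ≠ z. If both tuples were in the domain
then n ≤ 2N, so the domain contains no orbit and equivariance is vacuous. -/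
theorem const_mem_inter (hπ : ∀ x, Function.minimalPeriod π x = s + 2) (z : A) {N : ℕ} {n : ℕ+}
    (hn : 2 * N < n) : (⟨n, restrict (FewNe z N) fun _ => z⟩ : Par A) ∈
      pPol (cycleRel (s + 2) π) ∩ pPol (binRel ((· ≤ ·) : A → A → Prop)) := by
  refine ⟨(restrict_mem_pPol_cycleRel (by omega) hπ).2 fun x hx => ?_,
    restrict_mem_pPol_le.2 fun _ _ _ _ _ => le_rfl⟩
  have h0 := hx 0
  have h1 := hx 1
  simp only [FewNe, pow_zero, pow_one, Equiv.Perm.one_apply] at h0 h1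
  by_contra hz
  have hcover : (Finset.univ : Finset (Fin n)) ⊆
      (Finset.univ.filter fun j => x j ≠ z) ∪ Finset.univ.filter fun j => π (x j) ≠ z := by
    intro j _
    simp only [Finset.mem_union, Finset.mem_filter, Finset.mem_univ, true_and]
    by_contra h
    push Not at h
    rw [h.1] at h
    exact hz h.2.symm
  have := (Finset.card_le_card hcover).trans (Finset.card_union_le _ _)
  rw [Finset.card_univ, Fintype.card_fin] at this
  omega

/-- On tuples allowed one coordinate different from z, the constant z is not a coordinate function.
-/
theorem const_notMem_polOn_coordRel [Nontrivial A] (z : A) {N : ℕ} (hN : 1 ≤ N) {n : ℕ+} :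
    (⟨n, restrict (FewNe z N) fun _ => z⟩ : Par A) ∉ polOn (coordRel n z N) := by
  intro h
  rw [restrict_mem_polOn] at h
  obtain ⟨j, hj⟩ := h (fun x => x.1) (fun j => ⟨j, fun _ => rfl⟩) fun x => x.2
  obtain ⟨w, hw⟩ := exists_ne z
  have hx : FewNe z N (Function.update (fun _ : Fin n => z) j w) := by
    refine le_trans (Finset.card_le_card (t := {j}) fun i hi => ?_) (by simpa using hN)
    rw [Finset.mem_singleton]
    by_contra h
    simp [h] at hi
  have := hj ⟨_, hx⟩
  simp only [Function.update_self] at this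
  exact hw this.symm

theorem not_isFinitelyGenerated_inter [Nontrivial A] (hst : 1 ≤ s ∨ 1 ≤ t)
    (E : Fin (t + 1) ×ₗ Fin (s + 2) ≃ A)
    (hE : ∀ x y, E x ≤ E y ↔ x ≤ y) (hπE : ∀ x, π (E x) = E (rot 1 x))
    (hπ : ∀ x, Function.minimalPeriod π x = s + 2) :
    ¬ IsFinitelyGenerated
      (pPol (cycleRel (s + 2) π) ∩ pPol (binRel ((· ≤ ·) : A → A → Prop))) := by
  rintro ⟨F, hfin, hsub, hgen⟩
  obtain ⟨z⟩ : Nonempty A := inferInstance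
  obtain ⟨N, hN⟩ := (hfin.image fun f : Par A => (f.1 : ℕ)).bddAbove
  -- The bound N + 1 replaces N so that it is positive even if N = 0.
  let n : ℕ+ := ⟨2 * (N + 1) + 1, by omega⟩
  have hF : F ⊆ polOn (coordRel n z (N + 1)) := fun f hf =>
    mem_polOn_coordRel hst E hE hπE hπ z n ((hN ⟨f, hf, rfl⟩).trans N.le_succ) (hsub hf)
  have hc := const_mem_inter hπ z (N := N + 1) (n := n) (Nat.lt_succ_self _)
  rw [← hgen] at hc
  exact const_notMem_polOn_coordRel z (by omega)
    (Set.mem_sInter.1 hc _ ⟨isPartialClone_polOn _, hF⟩)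

end NotFinitelyGenerated

/-- A block rotation is, up to an order isomorphism, the rotation of `Fin q ×ₗ Fin (s + 2)`. -/
theorem IsBlockRotation.exists_equiv {q s : ℕ} {le : Fin (q * (s + 2)) → Fin (q * (s + 2)) → Prop}
    {π : Equiv.Perm (Fin (q * (s + 2)))} (h : IsBlockRotation (s + 2) le π) :
    ∃ E : Fin q ×ₗ Fin (s + 2) ≃ Fin (q * (s + 2)),
      (∀ x y, le (E x) (E y) ↔ x ≤ y) ∧ ∀ x, π (E x) = E (rot 1 x) := by
  obtain ⟨e, he, hπ⟩ := h
  refine ⟨(ofLex.trans finProdFinEquiv).trans e, fun x y => ?_, fun x => ?_⟩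
  · obtain ⟨b, i, rfl⟩ := exists_eq_toLex x
    obtain ⟨b', i', rfl⟩ := exists_eq_toLex y
    simp only [Equiv.trans_apply, ofLex_toLex]
    rw [he, toLex_le_iff, Fin.le_def, Fin.le_def, Fin.lt_def, Fin.ext_iff]
    simp only [finProdFinEquiv_apply_val]
    have hi := i.2
    have hi' := i'.2
    rcases lt_trichotomy (b : ℕ) b' with hb | hb | hb
    · have : (s + 2) * (b + 1 : ℕ) ≤ (s + 2) * b' := Nat.mul_le_mul_left _ hb
      rw [mul_add] at this
      simp only [hb, true_or, iff_true]
      omega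
    · simp [hb]
    · have : (s + 2) * (b' + 1 : ℕ) ≤ (s + 2) * b := Nat.mul_le_mul_left _ hb
      rw [mul_add] at this
      simp only [hb.not_gt, hb.ne', false_and, or_self, iff_false]
      omega
  · obtain ⟨b, i, rfl⟩ := exists_eq_toLex x
    refine hπ _ _ ?_
    change ((finProdFinEquiv (b, i + 1) : Fin (q * (s + 2))) : ℕ) =
      if s + 2 ∣ ((finProdFinEquiv (b, i) : Fin (q * (s + 2))) : ℕ) + 1 then
        ((finProdFinEquiv (b, i) : Fin (q * (s + 2))) : ℕ) + 1 - (s + 2)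
      else ((finProdFinEquiv (b, i) : Fin (q * (s + 2))) : ℕ) + 1
    simp only [finProdFinEquiv_apply_val]
    simp only [add_right_comm _ _ 1, Nat.dvd_add_left (Nat.dvd_mul_right (s + 2) (b : ℕ))]
    have hi := i.2
    -- Modulo the block length only i + 1 matters, so the wrap-around occurs exactly at the last
    -- position of a block.
    by_cases hl : (i : ℕ) = s + 1
    · have : i = Fin.last (s + 1) := Fin.ext hl
      rw [this, Fin.last_add_one]
      simp [add_right_comm s 1]
    · have hne : ¬ s + 2 ∣ (i : ℕ) + 1 := fun hd => by
        have := Nat.le_of_dvd (by omega) hd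
        omega
      rw [if_neg hne, Fin.val_add, Fin.val_one, Nat.mod_eq_of_lt (by omega)]

/-- The bundled linear order of an unbundled one. -/
noncomputable abbrev linearOrderOf {A : Type*} (le : A → A → Prop) (hle : IsLinearOrder A le) :
    LinearOrder A where
  le := le
  le_refl := hle.refl
  le_trans := hle.trans
  le_antisymm := hle.antisymm
  le_total := hle.total
  toDecidableLE := Classical.decRel _

end PartialClones

theorem mainTheorem2 (k : ℕ) (hk : 3 ≤ k) (p : ℕ) (hp : p.Prime) (hpk : p ∣ k)
    (π : Equiv.Perm (Fin k)) (hπ : ∀ x, Function.minimalPeriod π x = p)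
    (le : Fin k → Fin k → Prop) (hle : IsLinearOrder (Fin k) le) :
    (PartialClones.IsMaximalPartialClone (PartialClones.pPol (PartialClones.cycleRel p π)) ∧
      PartialClones.IsFinitelyGenerated (PartialClones.pPol (PartialClones.cycleRel p π))) ∧
    (PartialClones.IsMaximalPartialClone (PartialClones.pPol (PartialClones.binRel le)) ∧
      PartialClones.IsFinitelyGenerated (PartialClones.pPol (PartialClones.binRel le))) ∧
    PartialClones.IsPartialClone
      (PartialClones.pPol (PartialClones.cycleRel p π) ∩
        PartialClones.pPol (PartialClones.binRel le)) ∧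
    (PartialClones.IsBlockRotation p le π →
      ¬ PartialClones.IsFinitelyGenerated
        (PartialClones.pPol (PartialClones.cycleRel p π) ∩
          PartialClones.pPol (PartialClones.binRel le))) := by
  classical
  have : Nontrivial (Fin k) := Fin.nontrivial_iff_two_le.2 (by omega)
  let ord : LinearOrder (Fin k) := PartialClones.linearOrderOf le hle
  refine ⟨⟨PartialClones.isMaximalPartialClone_pPol_cycleRel hp.one_lt hπ,
      PartialClones.isFinitelyGenerated_pPol_cycleRel hp.one_lt hπ⟩,
    ⟨@PartialClones.isMaximalPartialClone_pPol_le _ ord _ _,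
      @PartialClones.isFinitelyGenerated_pPol_le _ ord _ _⟩,
    (PartialClones.isPartialClone_pPol _).inter (PartialClones.isPartialClone_pPol _),
    fun hrot => ?_⟩
  obtain ⟨q, rfl⟩ := exists_eq_mul_left_of_dvd hpk
  obtain ⟨s, rfl⟩ : ∃ s, p = s + 2 := ⟨p - 2, by have := hp.two_le; omega⟩
  obtain ⟨t, rfl⟩ : ∃ t, q = t + 1 := ⟨q - 1, by
    rcases q with _ | q
    · omega
    · rfl⟩
  obtain ⟨E, hE, hπE⟩ := hrot.exists_equiv
  -- The case s = t = 0 means k = 2, excluded by 3 ≤ k.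
  have hst : 1 ≤ s ∨ 1 ≤ t := by
    by_contra h
    obtain ⟨rfl, rfl⟩ : s = 0 ∧ t = 0 := by omega
    omega
  exact @PartialClones.not_isFinitelyGenerated_inter _ ord s t π _ hst E hE hπE hπ
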